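/- Let $n>2$ and let $X\subset\mathbb{C}^n$ be a closed algebraic curve, i.e. the zero set of a family of polynomials, of dimension one (possibly reducible and singular). Let $B(r)\subset\mathbb{C}^2$ denote the Euclidean ball of radius $r$ centred at $0$. Then there are a surjective $\mathbb{C}$-linear map $\pi:\mathbb{C}^n\to\mathbb{C}^2$ whose restriction $\pi|_X:X\to\mathbb{C}^2$ is proper, and a real number $r>0$, such that $\pi$ restricted to $X\setminus\pi^{-1}(B(r))$ is a bi-Lipschitz embedding into $\mathbb{C}^2\setminus B(r)$, i.e. it is bi-Lipschitz onto its image for the Euclidean distances of $\mathbb{C}^n$ and $\mathbb{C}^2$. In particular, $X$ is bi-Lipschitz equivalent at infinity to its generic plane projection: there is a non-empty Zariski open subset $U$ of the space of linear maps $\mathbb{C}^n\to\mathbb{C}^2$ such that for every surjective $\pi\in U$ there are compact sets $K_1\subset\mathbb{C}^n$, $K_2\subset\mathbb{C}^2$ and a bi-Lipschitz homeomorphism $X\setminus K_1\to\pi(X)\setminus K_2$ (for the induced Euclidean distances). -/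

import Mathlib

open scoped NNReal

noncomputable section

/-- `X ⊆ ℂⁿ` is a (closed) algebraic set: the set of common zeros of an ideal of polynomials. -/
def IsAlgebraicSet {n : ℕ} (X : Set (EuclideanSpace ℂ (Fin n))) : Prop :=
  ∃ I : Ideal (MvPolynomial (Fin n) ℂ),
    X = {x | WithLp.ofLp x ∈ MvPolynomial.zeroLocus ℂ I}

/-- The ideal of all polynomials vanishing on `X ⊆ ℂⁿ`. -/
def idealOf {n : ℕ} (X : Set (EuclideanSpace ℂ (Fin n))) : Ideal (MvPolynomial (Fin n) ℂ) :=
  MvPolynomial.vanishingIdeal ℂ (WithLp.ofLp '' X)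

/-- A closed algebraic curve in `ℂⁿ`: an algebraic set of dimension one, that is, one whose
coordinate ring has Krull dimension one. It may be reducible and singular. -/
def IsClosedAlgebraicCurve {n : ℕ} (X : Set (EuclideanSpace ℂ (Fin n))) : Prop :=
  IsAlgebraicSet X ∧ ringKrullDim (MvPolynomial (Fin n) ℂ ⧸ idealOf X) = 1

/-- `f` restricted to `s` is bi-Lipschitz onto its image. -/
def IsBiLipschitzEmbeddingOn {E F : Type*} [PseudoEMetricSpace E] [PseudoEMetricSpace F]
    (f : E → F) (s : Set E) : Prop :=
  ∃ K L : ℝ≥0, LipschitzWith K (s.domRestrict f) ∧ AntilipschitzWith L (s.domRestrict f)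

/-- `X` and `Y` are bi-Lipschitz equivalent at infinity: outside compact sets they are
related by a bi-Lipschitz homeomorphism (for the distances of the ambient spaces). -/
def BiLipschitzEquivalentAtInfinity {E F : Type*} [PseudoEMetricSpace E] [PseudoEMetricSpace F]
    (X : Set E) (Y : Set F) : Prop :=
  ∃ (A : Set E) (B : Set F), IsCompact A ∧ IsCompact B ∧
    ∃ φ : ↥(X \ A) ≃ₜ ↥(Y \ B), ∃ K L : ℝ≥0, LipschitzWith K φ ∧ LipschitzWith L φ.symm

/-- A property `P` holds for the generic plane projection of `ℂⁿ`: it holds for all surjective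
linear maps `π : ℂⁿ → ℂ²` in a non-empty Zariski open set, namely for those whose matrix entries
are not a zero of a certain nonzero polynomial. -/
def ForGenericPlaneProjection (n : ℕ)
    (P : (EuclideanSpace ℂ (Fin n) →ₗ[ℂ] EuclideanSpace ℂ (Fin 2)) → Prop) : Prop :=
  ∃ f : MvPolynomial (Fin 2 × Fin n) ℂ, f ≠ 0 ∧
    ∀ π : EuclideanSpace ℂ (Fin n) →ₗ[ℂ] EuclideanSpace ℂ (Fin 2),
      Function.Surjective π →
      MvPolynomial.eval (fun ij => π (EuclideanSpace.single ij.2 1) ij.1) f ≠ 0 → P π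

end

/-!
A linear projection `π` is bi-Lipschitz on `X` near infinity as soon as no limit of secant directions
`[x - y]`, with `x, y ∈ X` and `x → ∞`, lies in `ker π`. The secants of a curve form a two-dimensional
family, so their limits at infinity form a cone of dimension at most two, which a generic kernel of
codimension two meets only in `0`. The proof makes this dimension count explicit, by polynomials.

By Noether normalization the coordinate ring of `X` is finite over `ℂ[T]`, so the functions on
`X × X` that are polynomials of degree at most `d` span a space of dimension `O(d²)`. There are about
`d³` monomials `p ^ a * q ^ b * z ^ (2 d - a - b) * t ^ m` in three linear forms `p, q, z` of the
secant `x - y` and one coordinate `t` of `x`, hence they satisfy a linear relation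
(`exists_relation`). It is homogeneous in `(p, q, z)`; dividing by the highest power of `t` and
letting `t → ∞` leaves a nonzero ternary form vanishing at all limits of secant directions.

Genericity comes from letting `p` and `q` have indeterminate coefficients, except that the
coordinate `z = w_j` is left out of them (`IsClosedAlgebraicCurve.exists_secant_relation`). If
`w ∈ ker π`, the two rows of `π` express `p` and `q` as `-π_{0j} w_j` and `-π_{1j} w_j`, and the
ternary form becomes `w_j ^ (2 d)` times a polynomial in the entries of `π`. That polynomial is not
zero, since the coefficients of the form do not involve `π_{0j}` and `π_{1j}`; where it does not
vanish, `w_j = 0` (`IsClosedAlgebraicCurve.exists_apply_eq_zero_of_tendsto`). With all `j` together,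
compactness of the unit sphere gives the bound `c ‖x - y‖ ≤ ‖π (x - y)‖` for all `x, y ∈ X` with
`‖x‖` large (`IsClosedAlgebraicCurve.exists_generic_secant_bound`). Since `y` is not required to be
large, fixing it yields properness of `π` on `X`, and the rest is formal.
-/

/-! ### Noether normalization of a curve -/

theorem ringKrullDim_le_of_isIntegral {R A : Type*} [CommRing R] [CommRing A] [Algebra R A]
    [Algebra.IsIntegral R A] [FaithfulSMul R A] : ringKrullDim R ≤ ringKrullDim A := by
  refine iSup_le fun l ↦ ?_
  obtain ⟨P, hP, hl⟩ := (Ideal.nonempty_primesOver (S := A) (RelSeries.head l).asIdeal)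
  obtain ⟨L, hL, -⟩ := Ideal.exists_ltSeries_of_hasGoingUp (S := A) l P
  rw [← hL]
  exact le_iSup (fun L : LTSeries (PrimeSpectrum A) ↦ ((L.length : ℕ) : WithBot ℕ∞)) L

/-- Noether normalization in dimension one. The map is in fact injective, but this is not needed. -/
theorem exists_finite_polynomial_algHom {k A : Type*} [Field k] [CommRing A] [Algebra k A]
    [Algebra.FiniteType k A] (h : ringKrullDim A = 1) :
    ∃ g : Polynomial k →ₐ[k] A, g.Finite := by
  have : Nontrivial A := by
    by_contra hA
    rw [not_nontrivial_iff_subsingleton] at hA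
    rw [ringKrullDim_eq_bot_of_subsingleton] at h
    exact absurd h (by decide)
  obtain ⟨s, g, hinj, hfin⟩ := exists_finite_inj_algHom_of_fg k A
  have hs : s ≤ 1 := by
    algebraize [g.toRingHom]
    have : Module.Finite (MvPolynomial (Fin s) k) A := hfin
    have : FaithfulSMul (MvPolynomial (Fin s) k) A :=
      (faithfulSMul_iff_algebraMap_injective _ _).2 hinj
    have := ringKrullDim_le_of_isIntegral (R := MvPolynomial (Fin s) k) (A := A)
    rw [h, MvPolynomial.ringKrullDim_of_isNoetherianRing, ringKrullDim_eq_zero_of_field] at this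
    simpa using this
  -- As `s ≤ 1`, the sum of the variables generates the polynomial ring in `s` variables.
  have : Subsingleton (Fin s) := Fin.subsingleton_iff_le_one.2 hs
  refine ⟨g.comp (Polynomial.aeval (∑ i, MvPolynomial.X i)), hfin.comp
    (AlgHom.Finite.of_surjective _ ?_)⟩
  rw [← AlgHom.range_eq_top, eq_top_iff, ← MvPolynomial.adjoin_range_X, Algebra.adjoin_le_iff]
  rintro _ ⟨i, rfl⟩
  refine ⟨Polynomial.X, ?_⟩
  have := Fintype.sum_subsingleton (fun i ↦ (MvPolynomial.X i : MvPolynomial (Fin s) k)) i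
  simpa using this

/-- Pointwise form of Noether normalization: the functions `a l` generate the polynomial functions
on the curve as a module over the polynomials in a single function `T`. Only the expansions of `1`
and of the products of a coordinate with a generator are recorded. -/
theorem IsClosedAlgebraicCurve.exists_generators {n : ℕ} {X : Set (EuclideanSpace ℂ (Fin n))}
    (hX : IsClosedAlgebraicCurve X) :
    ∃ (s : ℕ) (T : X → ℂ) (a : Fin s → X → ℂ),
      (∃ c : Fin s → Polynomial ℂ, ∀ x, 1 = ∑ l, (c l).eval (T x) * a l x) ∧
      ∀ i k, ∃ c : Fin s → Polynomial ℂ, ∀ x : X,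
        x.1 i * a k x = ∑ l, (c l).eval (T x) * a l x := by
  obtain ⟨g, hg⟩ := exists_finite_polynomial_algHom (k := ℂ) hX.2
  algebraize [g.toRingHom]
  have : Module.Finite (Polynomial ℂ) (MvPolynomial (Fin n) ℂ ⧸ idealOf X) := hg
  obtain ⟨s, a, ha⟩ := Module.Finite.exists_fin (R := Polynomial ℂ)
    (M := MvPolynomial (Fin n) ℂ ⧸ idealOf X)
  -- evaluation at the point `x` of the curve
  let ev (x : X) : MvPolynomial (Fin n) ℂ ⧸ idealOf X →ₐ[ℂ] ℂ :=
    Ideal.Quotient.liftₐ (idealOf X) (MvPolynomial.aeval (WithLp.ofLp x.1))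
      (fun p hp ↦ hp _ ⟨x, x.2, rfl⟩)
  have key (b : MvPolynomial (Fin n) ℂ ⧸ idealOf X) : ∃ c : Fin s → Polynomial ℂ, ∀ x : X,
      ev x b = ∑ l, (c l).eval (ev x (g Polynomial.X)) * ev x (a l) := by
    have hb : b ∈ Submodule.span (Polynomial ℂ) (Set.range a) := ha ▸ Submodule.mem_top
    obtain ⟨c, rfl⟩ := (Submodule.mem_span_range_iff_exists_fun _).1 hb
    refine ⟨c, fun x ↦ ?_⟩
    rw [map_sum]
    refine Finset.sum_congr rfl fun l _ ↦ ?_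
    rw [Algebra.smul_def, map_mul]
    congr 1
    change ((ev x).comp g) (c l) = _
    rw [← Polynomial.coe_aeval_eq_eval]
    exact (DFunLike.congr_fun (Polynomial.aeval_algHom ((ev x).comp g) Polynomial.X)
      (c l)).symm ▸ by simp
  refine ⟨s, fun x ↦ ev x (g Polynomial.X), fun l x ↦ ev x (a l), ?_, fun i k ↦ ?_⟩
  · simpa using key 1
  · obtain ⟨c, hc⟩ := key (Ideal.Quotient.mk _ (MvPolynomial.X i) * a k)
    refine ⟨c, fun x ↦ ?_⟩
    rw [← hc x, map_mul]
    congr 1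
    simp [ev]

/-! ### Algebraic relations from a dimension count -/

section
variable (R : Type*) {S ι : Type*} [CommRing R] [CommRing S] [Algebra R S]

/-- The `R`-span of `U ^ u * V ^ v * a l` with `u, v ≤ d`. These spans filter the
`R[U, V]`-module generated by the `a l`, and level `d` is spanned by `O(d²)` elements if `ι`
is finite. -/
def boxSpan (U V : S) (a : ι → S) (d : ℕ) : Submodule R S :=
  Submodule.span R (Set.range fun j : Fin (d + 1) × Fin (d + 1) × ι ↦
    U ^ (j.1 : ℕ) * V ^ (j.2.1 : ℕ) * a j.2.2)

variable {R} {U V : S} {a : ι → S}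

theorem mem_boxSpan {d u v : ℕ} (hu : u ≤ d) (hv : v ≤ d) (l : ι) :
    U ^ u * V ^ v * a l ∈ boxSpan R U V a d :=
  Submodule.subset_span
    ⟨(⟨u, Nat.lt_succ_of_le hu⟩, ⟨v, Nat.lt_succ_of_le hv⟩, l), rfl⟩

theorem boxSpan_mono : Monotone (boxSpan R U V a) := by
  intro d e h
  refine Submodule.span_le.2 ?_
  rintro _ ⟨⟨u, v, l⟩, rfl⟩
  exact mem_boxSpan (by grind) (by grind) l

theorem pow_mul_pow_mul_mem_boxSpan {d e u v : ℕ} (hu : u ≤ d) (hv : v ≤ d) {x : S}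
    (hx : x ∈ boxSpan R U V a e) : U ^ u * V ^ v * x ∈ boxSpan R U V a (d + e) := by
  induction hx using Submodule.span_induction with
  | mem x hx =>
    obtain ⟨⟨u', v', l⟩, rfl⟩ := hx
    have := mem_boxSpan (R := R) (U := U) (V := V) (a := a) (d := d + e) (u := u + u')
      (v := v + v') (by grind) (by grind) l
    convert this using 1
    dsimp only
    ring
  | zero => simp
  | add x y _ _ hx hy => rw [mul_add]; exact add_mem hx hy
  | smul r x _ hx => rw [mul_smul_comm]; exact Submodule.smul_mem _ r hx

theorem mul_mem_boxSpan {d e : ℕ} {p x : S} (hp : ∀ l, p * a l ∈ boxSpan R U V a e)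
    (hx : x ∈ boxSpan R U V a d) : p * x ∈ boxSpan R U V a (d + e) := by
  induction hx using Submodule.span_induction with
  | mem x hx =>
    obtain ⟨⟨u, v, l⟩, rfl⟩ := hx
    have := pow_mul_pow_mul_mem_boxSpan (u := u) (v := v) (d := d) (by grind) (by grind) (hp l)
    convert this using 1
    dsimp only
    ring
  | zero => simp
  | add x y _ _ hx hy => rw [mul_add]; exact add_mem hx hy
  | smul r x _ hx => rw [mul_smul_comm]; exact Submodule.smul_mem _ r hx

theorem pow_mul_mem_boxSpan {d e : ℕ} {p x : S} (hp : ∀ l, p * a l ∈ boxSpan R U V a e)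
    (hx : x ∈ boxSpan R U V a d) (k : ℕ) : p ^ k * x ∈ boxSpan R U V a (d + k * e) := by
  induction k with
  | zero => simpa using hx
  | succ k ih =>
    have := mul_mem_boxSpan hp ih
    rw [pow_succ', mul_assoc, add_mul, one_mul, ← add_assoc]
    exact this

theorem eventually_mem_boxSpan {x : S}
    (hx : x ∈ Submodule.span R (Set.range fun j : ℕ × ℕ × ι ↦ U ^ j.1 * V ^ j.2.1 * a j.2.2)) :
    ∀ᶠ e in Filter.atTop, x ∈ boxSpan R U V a e := by
  induction hx using Submodule.span_induction with
  | mem x hx =>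
    obtain ⟨⟨u, v, l⟩, rfl⟩ := hx
    filter_upwards [Filter.eventually_ge_atTop u, Filter.eventually_ge_atTop v] with e hu hv
    exact mem_boxSpan hu hv l
  | zero => simp
  | add x y _ _ hx hy => filter_upwards [hx, hy] with e hx hy using add_mem hx hy
  | smul r x _ hx => filter_upwards [hx] with e hx using Submodule.smul_mem _ r hx

/-- If `1` and the products of `p, q, z, t` with the `a l` lie in the `R[U, V]`-span of the `a l`,
then a product of at most `3 * N` factors from `p, q, z, t` lies in a box span with `O(N²)` generators.
So the `N ^ 3` monomials below, homogeneous of degree `2 * N` in `(p, q, z)`, are linearly dependent. -/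
theorem exists_relation [Nontrivial R] [Finite ι] {p q z t : S}
    (h1 : (1 : S) ∈ Submodule.span R
      (Set.range fun j : ℕ × ℕ × ι ↦ U ^ j.1 * V ^ j.2.1 * a j.2.2))
    (h : ∀ y ∈ ({p, q, z, t} : Set S), ∀ l, y * a l ∈ Submodule.span R
      (Set.range fun j : ℕ × ℕ × ι ↦ U ^ j.1 * V ^ j.2.1 * a j.2.2)) :
    ∃ (N : ℕ) (g : Fin N × Fin N × Fin N → R), g ≠ 0 ∧
      ∑ j, g j • (p ^ (j.2.1 : ℕ) * q ^ (j.2.2 : ℕ) *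
        z ^ (2 * N - j.2.1 - j.2.2) * t ^ (j.1 : ℕ)) = 0 := by
  classical
  have := Fintype.ofFinite ι
  have h' (y : S) (hy : y ∈ ({p, q, z, t} : Set S)) :
      ∀ᶠ e in Filter.atTop, ∀ l, y * a l ∈ boxSpan R U V a e :=
    Filter.eventually_all.2 fun l ↦ eventually_mem_boxSpan (h y hy l)
  obtain ⟨e, he1, hp, hq, hz, ht⟩ := ((eventually_mem_boxSpan h1).and
    ((h' p (by simp)).and ((h' q (by simp)).and ((h' z (by simp)).and (h' t (by simp)))))).exists
  -- The box span of level `d` has at most `(d + 1) ^ 2 * s ≤ s * (4 * e + 1) ^ 2 * N ^ 2`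
  -- generators, which is less than `N ^ 3` for this `N`.
  let s := Fintype.card ι
  let N := s * (4 * e + 1) ^ 2 + 1
  let d := e + 3 * N * e
  have hd : d + 1 ≤ (4 * e + 1) * N := by
    have : 1 ≤ N := by omega
    have := Nat.mul_le_mul_left e this
    simp only [d]
    nlinarith
  have hcard : (d + 1) * ((d + 1) * s) < N * (N * N) := by
    calc (d + 1) * ((d + 1) * s) ≤ ((4 * e + 1) * N) * (((4 * e + 1) * N) * s) := by gcongr
      _ = (s * (4 * e + 1) ^ 2) * (N * N) := by ring
      _ < N * (N * N) := Nat.mul_lt_mul_of_pos_right (by omega) (by positivity)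
  let v : Fin N × Fin N × Fin N → S := fun j ↦ p ^ (j.2.1 : ℕ) * q ^ (j.2.2 : ℕ) *
        z ^ (2 * N - j.2.1 - j.2.2) * t ^ (j.1 : ℕ)
  have hv : Set.range v ≤ boxSpan R U V a d := by
    rintro _ ⟨⟨m, b, c⟩, rfl⟩
    have := pow_mul_mem_boxSpan hp (pow_mul_mem_boxSpan hq (pow_mul_mem_boxSpan hz
      (pow_mul_mem_boxSpan ht he1 m) (2 * N - b - c)) c) b
    have hle : e + m * e + (2 * N - b - c) * e + c * e + b * e ≤ d := by
      have : (m + (2 * N - b - c) + c + b) * e ≤ 3 * N * e := by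
        gcongr
        omega
      simp only [d]
      linarith
    have := boxSpan_mono hle this
    change p ^ (b : ℕ) * q ^ (c : ℕ) * z ^ (2 * N - b - c) * t ^ (m : ℕ) ∈ boxSpan R U V a d
    simpa only [mul_assoc, mul_one] using this
  have hdep : ¬ LinearIndependent R v := by
    intro hli
    have h1 := linearIndependent_le_span_aux' v hli _ hv
    have h2 := Fintype.card_le_of_surjective _ (Set.rangeFactorization_surjective
      (f := fun j : Fin (d + 1) × Fin (d + 1) × ι ↦ U ^ (j.1 : ℕ) * V ^ (j.2.1 : ℕ) * a j.2.2))
    have h3 := h1.trans h2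
    simp only [Fintype.card_prod, Fintype.card_fin] at h3
    exact absurd h3 (not_le.2 hcard)
  obtain ⟨g, hg, i, hi⟩ := Fintype.not_linearIndependent_iff.1 hdep
  exact ⟨N, g, fun h0 ↦ hi (by simp [h0]), hg⟩

end

/-! ### Homogeneous relations between the coordinates of a secant -/

open MvPolynomial in
/-- For `x, y` on the curve, let `d = x - y`, let `p` and `q` be linear forms in the `d l` with
`l ≠ j` whose coefficients `L` are indeterminate, and let `z = d j`. Then `p, q, z` and the coordinate
`x i` satisfy a nontrivial relation, homogeneous in `(p, q, z)`, with coefficients polynomial in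
`L`. -/
theorem IsClosedAlgebraicCurve.exists_secant_relation {n : ℕ} {X : Set (EuclideanSpace ℂ (Fin n))}
    (hX : IsClosedAlgebraicCurve X) (i j : Fin n) :
    ∃ (N : ℕ) (g : Fin N × Fin N × Fin N → MvPolynomial (Fin 2 × {l // l ≠ j}) ℂ), g ≠ 0 ∧
      ∀ (L : Fin 2 × {l // l ≠ j} → ℂ), ∀ x ∈ X, ∀ y ∈ X,
        ∑ m, eval L (g m) * ((∑ l, L (0, l) * (x - y) l) ^ (m.2.1 : ℕ) *
          (∑ l, L (1, l) * (x - y) l) ^ (m.2.2 : ℕ) *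
          (x - y) j ^ (2 * N - m.2.1 - m.2.2) * x i ^ (m.1 : ℕ)) = 0 := by
  obtain ⟨s, T, a, ⟨c₁, hc₁⟩, hmul⟩ := hX.exists_generators
  let R := MvPolynomial (Fin 2 × {l // l ≠ j}) ℂ
  -- The relation is found in the `R`-algebra of functions of a parameter and two points of `X`.
  let Ω := (Fin 2 × {l // l ≠ j} → ℂ) × X × X
  let ev : R →+* (Ω → ℂ) := RingHom.pi fun ω ↦ eval ω.1
  let : Algebra R (Ω → ℂ) := ev.toAlgebra
  have smul_apply (r : R) (f : Ω → ℂ) (ω : Ω) : (r • f) ω = eval ω.1 r * f ω := rfl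
  let U : Ω → ℂ := fun ω ↦ T ω.2.1
  let V : Ω → ℂ := fun ω ↦ T ω.2.2
  let b : Fin s × Fin s → Ω → ℂ := fun k ω ↦ a k.1 ω.2.1 * a k.2 ω.2.2
  let F : Submodule R (Ω → ℂ) := Submodule.span R
    (Set.range fun k : ℕ × ℕ × (Fin s × Fin s) ↦ U ^ k.1 * V ^ k.2.1 * b k.2.2)
  have hF (c c' : Polynomial ℂ) (k : Fin s × Fin s) :
      (fun ω : Ω ↦ c.eval (T ω.2.1) * c'.eval (T ω.2.2) * b k ω) ∈ F := by
    have : (fun ω : Ω ↦ c.eval (T ω.2.1) * c'.eval (T ω.2.2) * b k ω) =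
        ∑ u ∈ Finset.range (c.natDegree + 1), ∑ v ∈ Finset.range (c'.natDegree + 1),
          (C (c.coeff u * c'.coeff v) : R) • (U ^ u * V ^ v * b k) := by
      ext ω
      simp only [Finset.sum_apply, smul_apply, Polynomial.eval_eq_sum_range,
        eval_C, Pi.mul_apply, Pi.pow_apply, U, V]
      rw [Finset.sum_mul_sum, Finset.sum_mul]
      refine Finset.sum_congr rfl fun u _ ↦ ?_
      rw [Finset.sum_mul]
      refine Finset.sum_congr rfl fun v _ ↦ ?_
      ring
    rw [this]
    exact sum_mem fun u _ ↦ sum_mem fun v _ ↦ Submodule.smul_mem _ _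
      (Submodule.subset_span ⟨(u, v, k), rfl⟩)
  -- the coordinate functions of the two points
  let ξ (l : Fin n) : Ω → ℂ := fun ω ↦ ω.2.1.1 l
  let η (l : Fin n) : Ω → ℂ := fun ω ↦ ω.2.2.1 l
  have hξ (l : Fin n) (k : Fin s × Fin s) : ξ l * b k ∈ F := by
    obtain ⟨c, hc⟩ := hmul l k.1
    have : ξ l * b k = ∑ k', fun ω : Ω ↦ (c k').eval (T ω.2.1) *
        (1 : Polynomial ℂ).eval (T ω.2.2) * b (k', k.2) ω := by
      ext ω
      simp only [ξ, b, Pi.mul_apply, Finset.sum_apply, ← mul_assoc, hc, Finset.sum_mul]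
      simp
    rw [this]
    exact sum_mem fun k' _ ↦ hF _ _ _
  have hη (l : Fin n) (k : Fin s × Fin s) : η l * b k ∈ F := by
    obtain ⟨c, hc⟩ := hmul l k.2
    have : η l * b k = ∑ k', fun ω : Ω ↦ (1 : Polynomial ℂ).eval (T ω.2.1) *
        (c k').eval (T ω.2.2) * b (k.1, k') ω := by
      ext ω
      simp only [η, b, Pi.mul_apply, Finset.sum_apply]
      rw [mul_left_comm, hc, Finset.mul_sum]
      refine Finset.sum_congr rfl fun k' _ ↦ ?_
      simp only [Polynomial.eval_one]
      ring
    rw [this]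
    exact sum_mem fun k' _ ↦ hF _ _ _
  have h1 : (1 : Ω → ℂ) ∈ F := by
    have : (1 : Ω → ℂ) = ∑ k, ∑ k', fun ω : Ω ↦ (c₁ k).eval (T ω.2.1) *
        (c₁ k').eval (T ω.2.2) * b (k, k') ω := by
      ext ω
      have := congr_arg₂ (· * ·) (hc₁ ω.2.1) (hc₁ ω.2.2)
      simp only [Finset.sum_mul_sum, mul_one] at this
      simp only [Pi.one_apply, Finset.sum_apply, this, b]
      refine Finset.sum_congr rfl fun u _ ↦ Finset.sum_congr rfl fun v _ ↦ ?_
      ring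
    rw [this]
    exact sum_mem fun k _ ↦ sum_mem fun k' _ ↦ hF _ _ _
  have hd (l : Fin n) (k : Fin s × Fin s) : (ξ l - η l) * b k ∈ F := by
    rw [sub_mul]
    exact sub_mem (hξ l k) (hη l k)
  let p (c : Fin 2) : Ω → ℂ := ∑ l, (MvPolynomial.X (c, l) : R) • (ξ l - η l)
  have hp (c : Fin 2) (k : Fin s × Fin s) : p c * b k ∈ F := by
    simp only [p, Finset.sum_mul, smul_mul_assoc]
    exact sum_mem fun l _ ↦ Submodule.smul_mem _ _ (hd _ _)
  obtain ⟨N, g, hg, h⟩ := exists_relation (R := R) (p := p 0) (q := p 1) (z := ξ j - η j)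
    (t := ξ i) h1 (by
      rintro _ (rfl | rfl | rfl | rfl)
      exacts [hp 0, hp 1, hd j, hξ i])
  refine ⟨N, g, hg, fun L x hx y hy ↦ ?_⟩
  have := congr_fun h (L, ⟨x, hx⟩, ⟨y, hy⟩)
  simpa [smul_apply, p, ξ, η] using this

/-! ### Limits of secant directions at infinity -/

section
open Filter Topology

theorem exists_sum_mul_pow_ne_zero {N : ℕ} {c : Fin N → ℂ} (hc : c ≠ 0) :
    ∃ u : ℂ, ∑ a, c a * u ^ (a : ℕ) ≠ 0 := by
  by_contra! h
  have hp : (∑ a : Fin N, Polynomial.monomial (a : ℕ) (c a)) = 0 :=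
    Polynomial.funext fun u ↦ by simpa [Polynomial.eval_finsetSum] using h u
  refine hc (funext fun a ↦ ?_)
  have := congr_arg (fun p ↦ Polynomial.coeff p a) hp
  simpa [Polynomial.finsetSum_coeff, Polynomial.coeff_monomial, Fin.val_inj] using this

theorem exists_sum_mul_pow_mul_pow_ne_zero {N : ℕ} {c : Fin N × Fin N → ℂ} (hc : c ≠ 0) :
    ∃ u v : ℂ, ∑ m, c m * (u ^ (m.1 : ℕ) * v ^ (m.2 : ℕ)) ≠ 0 := by
  obtain ⟨⟨a, b⟩, hab⟩ := Function.ne_iff.1 hc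
  obtain ⟨v, hv⟩ := exists_sum_mul_pow_ne_zero (c := fun b ↦ c (a, b))
    (Function.ne_iff.2 ⟨b, hab⟩)
  obtain ⟨u, hu⟩ := exists_sum_mul_pow_ne_zero
    (c := fun a ↦ ∑ b, c (a, b) * v ^ (b : ℕ)) (Function.ne_iff.2 ⟨a, hv⟩)
  refine ⟨u, v, ?_⟩
  convert hu using 1
  rw [Fintype.sum_prod_type]
  refine Finset.sum_congr rfl fun a _ ↦ ?_
  rw [Finset.sum_mul]
  exact Finset.sum_congr rfl fun b _ ↦ by ring

open MvPolynomial in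
/-- For generic `L`, any limit `w` of rescaled secants of the curve, taken along points `x` whose
`i`-th coordinate tends to infinity, has `w j = 0` if both linear forms given by `L` vanish
at `w`. -/
theorem IsClosedAlgebraicCurve.exists_apply_eq_zero_of_tendsto {n : ℕ}
    {X : Set (EuclideanSpace ℂ (Fin n))} (hX : IsClosedAlgebraicCurve X) (i j : Fin n) :
    ∃ f : MvPolynomial (Fin 2 × Fin n) ℂ, f ≠ 0 ∧ ∀ L, eval L f ≠ 0 →
      ∀ {ι : Type} (F : Filter ι) [F.NeBot] (x y : ι → EuclideanSpace ℂ (Fin n)) (σ : ι → ℂ)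
        (w : EuclideanSpace ℂ (Fin n)), (∀ k, x k ∈ X) → (∀ k, y k ∈ X) →
        Tendsto (fun k ↦ ‖x k i‖) F atTop → Tendsto (fun k ↦ σ k • (x k - y k)) F (𝓝 w) →
        (∀ c, ∑ l, L (c, l) * w l = 0) → w j = 0 := by
  classical
  obtain ⟨N, g, hg, h⟩ := hX.exists_secant_relation i j
  obtain ⟨m₀, hm₀, hmax⟩ := Finset.exists_max_image (Finset.univ.filter fun m ↦ g m ≠ 0)
    (fun m ↦ m.1) (by
      obtain ⟨m, hm⟩ := Function.ne_iff.1 hg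
      exact ⟨m, by simpa using hm⟩)
  simp only [Finset.mem_filter, Finset.mem_univ, true_and] at hm₀ hmax
  -- the highest power of `x i` in the relation
  let M := m₀.1
  let e : Fin 2 × {l // l ≠ j} → Fin 2 × Fin n := Prod.map id Subtype.val
  let f : MvPolynomial (Fin 2 × Fin n) ℂ :=
    ∑ m : Fin N × Fin N, rename e (g (M, m)) *
      ((-.X (0, j)) ^ (m.1 : ℕ) * (-.X (1, j)) ^ (m.2 : ℕ))
  have hf (L : Fin 2 × Fin n → ℂ) : eval L f = ∑ m : Fin N × Fin N, eval (L ∘ e) (g (M, m)) *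
      ((-L (0, j)) ^ (m.1 : ℕ) * (-L (1, j)) ^ (m.2 : ℕ)) := by
    simp [f, eval_rename]
  -- `f ≠ 0`: choose the entries outside column `j` so that a coefficient `g (M, m)` does not vanish,
  -- and then the two entries in column `j`, on which these coefficients do not depend.
  refine ⟨f, fun hf0 ↦ ?_, fun L hL ι F _ x y σ w hx hy hxi hw hLw ↦ ?_⟩
  · obtain ⟨L', hL'⟩ : ∃ L', eval L' (g m₀) ≠ 0 := by
      by_contra! h0
      exact hm₀ (funext fun L' ↦ by simpa using h0 L')
    obtain ⟨u, v, huv⟩ := exists_sum_mul_pow_mul_pow_ne_zero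
      (c := fun m ↦ eval L' (g (M, m))) (Function.ne_iff.2 ⟨m₀.2, hL'⟩)
    let L : Fin 2 × Fin n → ℂ := fun cl ↦
      if hl : cl.2 = j then (if cl.1 = 0 then -u else -v) else L' (cl.1, ⟨cl.2, hl⟩)
    have hLe : L ∘ e = L' := by
      ext ⟨c, l, hl⟩
      simp [L, e, hl]
    have := hf L
    rw [hf0, hLe] at this
    refine huv ?_
    simpa [L] using this.symm
  · have hcoord (l : Fin n) : Tendsto (fun k ↦ σ k * (x k - y k) l) F (𝓝 (w l)) :=
      ((EuclideanSpace.proj (𝕜 := ℂ) l).continuous.tendsto w).comp hw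
    have hform (c : Fin 2) :
        Tendsto (fun k ↦ ∑ l : {l // l ≠ j}, L (c, l) * (σ k * (x k - y k) l)) F
          (𝓝 (-L (c, j) * w j)) := by
      have : -L (c, j) * w j = ∑ l : {l // l ≠ j}, L (c, l) * w l := by
        have := hLw c
        rw [Fintype.sum_eq_add_sum_subtype_ne _ j] at this
        linear_combination -this
      rw [this]
      exact tendsto_finsetSum _ fun l _ ↦ (hcoord l).const_mul _
    have hratio (m : Fin N × Fin N × Fin N) : Tendsto (fun k ↦ eval (L ∘ e) (g m) *
        (x k i ^ (m.1 : ℕ) / x k i ^ (M : ℕ))) F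
        (𝓝 (if m.1 = M then eval (L ∘ e) (g m) else 0)) := by
      by_cases hm : g m = 0
      · simp [hm]
      have hle : m.1 ≤ M := hmax m hm
      have hne : ∀ᶠ k in F, x k i ≠ 0 := by
        filter_upwards [hxi.eventually_gt_atTop 0] with k hk using norm_pos_iff.1 hk
      split_ifs with hmM
      · refine tendsto_const_nhds.congr' ?_
        filter_upwards [hne] with k hk
        rw [hmM, div_self (pow_ne_zero _ hk), mul_one]
      · have hlt : (m.1 : ℕ) < M := lt_of_le_of_ne hle (fun h ↦ hmM (Fin.ext h))
        have h0 : Tendsto (fun k ↦ (x k i)⁻¹ ^ ((M : ℕ) - m.1)) F (𝓝 0) := by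
          have : Tendsto (fun k ↦ (x k i)⁻¹) F (𝓝 0) :=
            tendsto_inv₀_cobounded.comp (tendsto_norm_atTop_iff_cobounded.1 hxi)
          simpa [zero_pow (Nat.sub_ne_zero_of_lt hlt)] using this.pow ((M : ℕ) - m.1)
        rw [← mul_zero (eval (L ∘ e) (g m))]
        refine (h0.congr' ?_).const_mul _
        filter_upwards [hne] with k hk
        rw [inv_pow, pow_sub₀ _ hk hlt.le]
        simp [div_eq_mul_inv]
    -- The relation times `σ k ^ (2 * N) / (x k i) ^ M` converges; only the terms with `m.1 = M`
    -- survive in the limit.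
    have hlim := tendsto_finsetSum Finset.univ fun (m : Fin N × Fin N × Fin N) _ ↦
      (hratio m).mul ((((hform 0).pow (m.2.1 : ℕ)).mul ((hform 1).pow (m.2.2 : ℕ))).mul
        ((hcoord j).pow (2 * N - m.2.1 - m.2.2)))
    have hzero := tendsto_nhds_unique (hlim.congr fun k ↦ ?_) (tendsto_const_nhds (x := (0 : ℂ)))
    · have hwj : w j ^ (2 * N) * eval L f = 0 := by
        rw [Fintype.sum_prod_type, Finset.sum_eq_single_of_mem M (Finset.mem_univ _)
          (fun m _ hm ↦ by simp [hm])] at hzero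
        rw [← hzero, hf, Finset.mul_sum]
        refine Finset.sum_congr rfl fun m _ ↦ ?_
        have : w j ^ (2 * N) = w j ^ (m.1 : ℕ) * w j ^ (m.2 : ℕ) * w j ^ (2 * N - m.1 - m.2) := by
          rw [← pow_add, ← pow_add]
          congr 1
          omega
        rw [this]
        simp only [if_true, mul_pow]
        ring
      exact eq_zero_of_pow_eq_zero ((mul_eq_zero.1 hwj).resolve_right hL)
    · have := congr_arg (fun r ↦ σ k ^ (2 * N) / x k i ^ (M : ℕ) * r)
        (h (L ∘ e) (x k) (hx k) (y k) (hy k))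
      simp only [mul_zero, Finset.mul_sum] at this
      rw [← this]
      refine Finset.sum_congr rfl fun m _ ↦ ?_
      have : σ k ^ (2 * N) =
          σ k ^ (m.2.1 : ℕ) * σ k ^ (m.2.2 : ℕ) * σ k ^ (2 * N - m.2.1 - m.2.2) := by
        rw [← pow_add, ← pow_add]
        congr 1
        omega
      have hs (c : Fin 2) : ∑ l : {l // l ≠ j}, L (c, l) * (σ k * (x k - y k) l) =
          σ k * ∑ l : {l // l ≠ j}, L (c, l) * (x k - y k) l := by
        rw [Finset.mul_sum]
        exact Finset.sum_congr rfl fun l _ ↦ by ring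
      rw [hs, hs, this]
      simp only [mul_pow, e, Function.comp_apply, Prod.map, id]
      ring

/-! ### The secant bound for generic projections -/

theorem EuclideanSpace.exists_norm_le_mul_norm_apply {n : ℕ} [NeZero n]
    (x : EuclideanSpace ℂ (Fin n)) : ∃ i, ‖x‖ ≤ n * ‖x i‖ := by
  obtain ⟨i, hi⟩ := Finite.exists_max (fun i ↦ ‖x i‖)
  refine ⟨i, ?_⟩
  have hn : (1 : ℝ) ≤ n := by exact_mod_cast NeZero.one_le
  refine le_of_sq_le_sq ?_ (by positivity)
  calc ‖x‖ ^ 2 = ∑ l, ‖x l‖ ^ 2 := EuclideanSpace.norm_sq_eq x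
    _ ≤ ∑ _l : Fin n, ‖x i‖ ^ 2 := Finset.sum_le_sum fun l _ ↦ by gcongr; exact hi l
    _ = n * ‖x i‖ ^ 2 := by simp
    _ ≤ (n * n) * ‖x i‖ ^ 2 := by gcongr; nlinarith
    _ = (n * ‖x i‖) ^ 2 := by ring

theorem EuclideanSpace.linearMap_apply_eq_sum {n m : ℕ}
    (π : EuclideanSpace ℂ (Fin n) →ₗ[ℂ] EuclideanSpace ℂ (Fin m))
    (w : EuclideanSpace ℂ (Fin n)) (c : Fin m) :
    π w c = ∑ l, π (EuclideanSpace.single l 1) c * w l := by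
  conv_lhs => rw [← (EuclideanSpace.basisFun (Fin n) ℂ).sum_repr w]
  simp [mul_comm]

/-- A generic projection does not contract secants of the curve with one end near infinity by more
than a constant factor. -/
theorem IsClosedAlgebraicCurve.exists_generic_secant_bound {n : ℕ} [NeZero n]
    {X : Set (EuclideanSpace ℂ (Fin n))} (hX : IsClosedAlgebraicCurve X) :
    ForGenericPlaneProjection n fun π ↦ ∃ c > 0, ∃ R : ℝ, ∀ x ∈ X, ∀ y ∈ X, R ≤ ‖x‖ →
      c * ‖x - y‖ ≤ ‖π (x - y)‖ := by
  choose f hf0 hf using hX.exists_apply_eq_zero_of_tendsto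
  refine ⟨∏ i, ∏ j, f i j,
    Finset.prod_ne_zero_iff.2 fun i _ ↦ Finset.prod_ne_zero_iff.2 fun j _ ↦ hf0 i j,
    fun π _ hπ ↦ ?_⟩
  have hπ' (i j : Fin n) :
      MvPolynomial.eval (fun ij ↦ π (EuclideanSpace.single ij.2 1) ij.1) (f i j) ≠ 0 := by
    rw [map_prod] at hπ
    have := Finset.prod_ne_zero_iff.1 hπ i (Finset.mem_univ _)
    rw [map_prod] at this
    exact Finset.prod_ne_zero_iff.1 this j (Finset.mem_univ _)
  -- Otherwise the unit directions of a sequence of secants accumulate at some `w ∈ ker π`. The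
  -- limit is taken along an ultrafilter, which also selects a coordinate `i₀` of `x k` that is
  -- comparable to `‖x k‖`.
  by_contra! hcon
  choose x hx y hy hxR hlt using fun k : ℕ ↦ hcon (1 / ((k : ℝ) + 1)) (by positivity) k
  have hne (k : ℕ) : ‖x k - y k‖ ≠ 0 := fun h0 ↦ by
    have := hlt k
    rw [h0, mul_zero] at this
    exact absurd this (norm_nonneg _).not_gt
  let σ : ℕ → ℂ := fun k ↦ ((‖x k - y k‖⁻¹ : ℝ) : ℂ)
  have hσ (k : ℕ) : ‖σ k‖ = ‖x k - y k‖⁻¹ := by simp [σ]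
  let F : Ultrafilter ℕ := hyperfilter ℕ
  have hFtop : (F : Filter ℕ) ≤ atTop := Nat.hyperfilter_le_atTop
  obtain ⟨w, hw1, hw⟩ := (isCompact_sphere (0 : EuclideanSpace ℂ (Fin n)) 1).ultrafilter_le_nhds
    (F.map fun k ↦ σ k • (x k - y k)) (by
      rw [le_principal_iff, Ultrafilter.coe_map]
      refine Filter.mem_map.2 (Filter.univ_mem' fun k ↦ ?_)
      simp [norm_smul, hσ, hne k])
  replace hw : Tendsto (fun k ↦ σ k • (x k - y k)) F (𝓝 w) := hw
  have hπw : π w = 0 := by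
    refine tendsto_nhds_unique
      ((π.continuous_of_finiteDimensional.tendsto w).comp hw) (squeeze_zero_norm (fun k ↦ ?_)
        (tendsto_one_div_add_atTop_nhds_zero_nat.mono_left hFtop))
    rw [Function.comp_apply, map_smul, norm_smul, hσ,
      inv_mul_le_iff₀ ((norm_nonneg _).lt_of_ne' (hne k)), mul_comm]
    exact (hlt k).le
  choose i hi using fun k ↦ EuclideanSpace.exists_norm_le_mul_norm_apply (x k)
  obtain ⟨i₀, hi₀⟩ := Ultrafilter.eq_pure_of_finite (F.map i)
  have hev : ∀ᶠ k in (F : Filter ℕ), i k = i₀ := by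
    have : {i₀} ∈ F.map i := by rw [hi₀]; exact Ultrafilter.mem_pure.2 rfl
    exact this
  have hn : (0 : ℝ) < n := by exact_mod_cast Nat.pos_of_neZero n
  have hxi : Tendsto (fun k ↦ ‖x k i₀‖) F atTop := by
    refine tendsto_atTop_mono' _ ?_
      ((tendsto_natCast_atTop_atTop.mono_left hFtop).atTop_div_const hn)
    filter_upwards [hev] with k hk
    rw [div_le_iff₀ hn, mul_comm, ← hk]
    exact (hxR k).trans (hi k)
  have hw0 : w = 0 := by
    ext j
    exact hf i₀ j _ (hπ' i₀ j) (F : Filter ℕ) x y σ w hx hy hxi hw fun c ↦ by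
      rw [← EuclideanSpace.linearMap_apply_eq_sum, hπw]; rfl
  simp [hw0] at hw1

end

/-! ### Properness and bi-Lipschitz estimates from the secant bound -/

theorem IsAlgebraicSet.isClosed {n : ℕ} {X : Set (EuclideanSpace ℂ (Fin n))}
    (hX : IsAlgebraicSet X) : IsClosed X := by
  obtain ⟨I, rfl⟩ := hX
  simp only [MvPolynomial.mem_zeroLocus_iff, Set.ofPred_forall]
  refine isClosed_biInter fun p _ ↦ isClosed_eq ?_ continuous_const
  simp only [MvPolynomial.aeval_eq_eval]
  exact (MvPolynomial.continuous_eval p).comp (PiLp.continuous_ofLp 2 _)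

/-- The surjective maps among the linear maps `ℂⁿ → ℂ²` are Zariski dense. -/
theorem exists_surjective_eval_ne_zero {n : ℕ} (hn : 2 ≤ n)
    {f : MvPolynomial (Fin 2 × Fin n) ℂ} (hf : f ≠ 0) :
    ∃ π : EuclideanSpace ℂ (Fin n) →ₗ[ℂ] EuclideanSpace ℂ (Fin 2), Function.Surjective π ∧
      MvPolynomial.eval (fun ij => π (EuclideanSpace.single ij.2 1) ij.1) f ≠ 0 := by
  let i₀ : Fin n := ⟨0, by omega⟩
  let i₁ : Fin n := ⟨1, by omega⟩
  have hi : i₁ ≠ i₀ := by simp [i₀, i₁]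
  -- a `2 × 2` minor, whose nonvanishing ensures surjectivity
  let D : MvPolynomial (Fin 2 × Fin n) ℂ :=
    .X (0, i₀) * .X (1, i₁) - .X (0, i₁) * .X (1, i₀)
  have hD : D ≠ 0 := fun h ↦ by
    have := congr_arg (MvPolynomial.eval fun ij : Fin 2 × Fin n ↦
      if ij = (0, i₀) ∨ ij = (1, i₁) then (1 : ℂ) else 0) h
    simp [D, hi, hi.symm] at this
  obtain ⟨L, hL⟩ : ∃ L, MvPolynomial.eval L (f * D) ≠ 0 := by
    by_contra! h0
    exact mul_ne_zero hf hD (MvPolynomial.funext fun L ↦ by simpa using h0 L)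
  rw [map_mul] at hL
  obtain ⟨hLf, hLD⟩ := mul_ne_zero_iff.1 hL
  let π : EuclideanSpace ℂ (Fin n) →ₗ[ℂ] EuclideanSpace ℂ (Fin 2) :=
    Matrix.toLpLin 2 2 (Matrix.of fun c l ↦ L (c, l))
  have hπ (c : Fin 2) (l : Fin n) : π (EuclideanSpace.single l 1) c = L (c, l) := by
    simp [π, Matrix.toLpLin_apply]
  refine ⟨π, fun v ↦ ?_, by simpa [hπ] using hLf⟩
  replace hLD : L (0, i₀) * L (1, i₁) - L (0, i₁) * L (1, i₀) ≠ 0 := by simpa [D] using hLD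
  obtain ⟨δ, hδ⟩ : ∃ δ, δ = L (0, i₀) * L (1, i₁) - L (0, i₁) * L (1, i₀) := ⟨_, rfl⟩
  rw [← hδ] at hLD
  refine ⟨((v 0 * L (1, i₁) - v 1 * L (0, i₁)) / δ) • EuclideanSpace.single i₀ 1 +
    ((v 1 * L (0, i₀) - v 0 * L (1, i₀)) / δ) • EuclideanSpace.single i₁ 1, ?_⟩
  ext c
  fin_cases c <;> simp [hπ] <;> field_simp <;> rw [hδ] <;> ring

section
variable {n : ℕ} {X : Set (EuclideanSpace ℂ (Fin n))}
  {π : EuclideanSpace ℂ (Fin n) →ₗ[ℂ] EuclideanSpace ℂ (Fin 2)} {c R : ℝ}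

theorem isProperMap_of_secant_bound (hX : IsClosed X) (hc : 0 < c)
    (h : ∀ x ∈ X, ∀ y ∈ X, R ≤ ‖x‖ → c * ‖x - y‖ ≤ ‖π (x - y)‖) :
    IsProperMap (X.domRestrict π) := by
  have hπ : Continuous π := π.continuous_of_finiteDimensional
  refine isProperMap_iff_isCompact_preimage.2 ⟨hπ.comp continuous_subtype_val, fun K hK ↦ ?_⟩
  rcases X.eq_empty_or_nonempty with rfl | ⟨x₀, hx₀⟩
  · exact (Set.toFinite _).isCompact
  rw [Subtype.isCompact_iff]
  obtain ⟨B, hB⟩ := hK.isBounded.exists_norm_le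
  have himage : Subtype.val '' (X.domRestrict π ⁻¹' K) = X ∩ π ⁻¹' K := by
    ext x
    simp [and_comm]
  rw [himage]
  refine Metric.isCompact_of_isClosed_isBounded (hX.inter (hK.isClosed.preimage hπ))
    (isBounded_iff_forall_norm_le.2 ⟨max R ((B + ‖π x₀‖) / c + ‖x₀‖), fun x hx ↦ ?_⟩)
  rcases le_or_gt R ‖x‖ with hR | hR
  · refine le_max_of_le_right ?_
    have h1 : c * ‖x - x₀‖ ≤ B + ‖π x₀‖ := by
      refine (h x hx.1 x₀ hx₀ hR).trans ?_
      rw [map_sub]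
      exact (norm_sub_le _ _).trans (by gcongr; exact hB _ hx.2)
    rw [← sub_le_iff_le_add, le_div_iff₀' hc]
    exact le_trans (by gcongr; exact norm_sub_norm_le _ _) h1
  · exact le_max_of_le_left hR.le

theorem exists_isBiLipschitzEmbeddingOn (hc : 0 < c)
    (h : ∀ x ∈ X, ∀ y ∈ X, R ≤ ‖x‖ → c * ‖x - y‖ ≤ ‖π (x - y)‖) :
    ∃ r : ℝ, 0 < r ∧ IsBiLipschitzEmbeddingOn π (X \ π ⁻¹' Metric.ball 0 r) := by
  let π' := LinearMap.toContinuousLinearMap π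
  refine ⟨‖π'‖ * |R| + 1, by positivity, ‖π'‖₊, (Real.toNNReal c)⁻¹,
    fun x y ↦ π'.lipschitz x y, ?_⟩
  refine AntilipschitzWith.of_le_mul_dist fun x y ↦ ?_
  have hx : R ≤ ‖x.1‖ := by
    by_contra! hlt
    refine x.2.2 ?_
    rw [Set.mem_preimage, mem_ball_zero_iff]
    calc ‖π' x.1‖ ≤ ‖π'‖ * ‖x.1‖ := π'.le_opNorm _
      _ ≤ ‖π'‖ * |R| := by gcongr; exact hlt.le.trans (le_abs_self R)
      _ < ‖π'‖ * |R| + 1 := lt_add_one _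
  have := h x.1 x.2.1 y.1 y.2.1 hx
  rw [Subtype.dist_eq, dist_eq_norm, dist_eq_norm, NNReal.coe_inv, Real.coe_toNNReal _ hc.le,
    le_inv_mul_iff₀ hc, Set.domRestrict_apply, Set.domRestrict_apply, ← map_sub]
  exact this

theorem biLipschitzEquivalentAtInfinity_image (hproper : IsProperMap (X.domRestrict π)) {r : ℝ}
    (h : IsBiLipschitzEmbeddingOn π (X \ π ⁻¹' Metric.ball 0 r)) :
    BiLipschitzEquivalentAtInfinity X (π '' X) := by
  obtain ⟨K, L, hK, hL⟩ := h
  let A := Subtype.val '' (X.domRestrict π ⁻¹' Metric.closedBall 0 r)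
  have hA (x : EuclideanSpace ℂ (Fin n)) : x ∈ X \ A ↔ x ∈ X ∧ π x ∉ Metric.closedBall 0 r := by
    simp only [A, Set.mem_sdiff, Set.mem_image, Set.mem_preimage, Set.domRestrict_apply,
      Subtype.exists, exists_and_right, exists_eq_right]
    grind
  have hsub (x : ↥(X \ A)) : x.1 ∈ X \ π ⁻¹' Metric.ball 0 r :=
    ⟨x.2.1, fun hx ↦ ((hA x).1 x.2).2 (Metric.ball_subset_closedBall hx)⟩
  let φ : ↥(X \ A) → ↥(π '' X \ Metric.closedBall 0 r) :=
    fun x ↦ ⟨π x, ⟨x, x.2.1, rfl⟩, ((hA x).1 x.2).2⟩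
  have hφK : LipschitzWith K φ := fun x y ↦ hK ⟨x, hsub x⟩ ⟨y, hsub y⟩
  have hφL : AntilipschitzWith L φ := fun x y ↦ hL ⟨x, hsub x⟩ ⟨y, hsub y⟩
  have hφ : Function.Bijective φ := by
    refine ⟨hφL.injective, ?_⟩
    rintro ⟨_, ⟨x, hx, rfl⟩, hxr⟩
    exact ⟨⟨x, (hA x).2 ⟨hx, hxr⟩⟩, rfl⟩
  let e := Equiv.ofBijective φ hφ
  have hinv : LipschitzWith L e.symm := hφL.to_rightInverse e.right_inv
  exact ⟨A, Metric.closedBall 0 r,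
    (hproper.isCompact_preimage (isCompact_closedBall 0 r)).image continuous_subtype_val,
    isCompact_closedBall 0 r, ⟨e, hφK.continuous, hinv.continuous⟩, K, L, hφK, hinv⟩

end

theorem theorem4 (n : ℕ) (hn : 2 < n) (X : Set (EuclideanSpace ℂ (Fin n)))
    (hX : IsClosedAlgebraicCurve X) :
    (∃ π : EuclideanSpace ℂ (Fin n) →ₗ[ℂ] EuclideanSpace ℂ (Fin 2),
      Function.Surjective π ∧ IsProperMap (X.domRestrict π) ∧
      ∃ r : ℝ, 0 < r ∧
        IsBiLipschitzEmbeddingOn π (X \ π ⁻¹' Metric.ball 0 r)) ∧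
    ForGenericPlaneProjection n
      (fun π => BiLipschitzEquivalentAtInfinity X (π '' X)) := by
  have : NeZero n := ⟨by omega⟩
  obtain ⟨f, hf, h⟩ := hX.exists_generic_secant_bound
  have hcl := hX.1.isClosed
  constructor
  · obtain ⟨π, hsurj, hπ⟩ := exists_surjective_eval_ne_zero hn.le hf
    obtain ⟨c, hc, R, hb⟩ := h π hsurj hπ
    exact ⟨π, hsurj, isProperMap_of_secant_bound hcl hc hb, exists_isBiLipschitzEmbeddingOn hc hb⟩
  · refine ⟨f, hf, fun π hsurj hπ ↦ ?_⟩
    obtain ⟨c, hc, R, hb⟩ := h π hsurj hπ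
    obtain ⟨r, -, hr⟩ := exists_isBiLipschitzEmbeddingOn hc hb
    exact biLipschitzEquivalentAtInfinity_image (isProperMap_of_secant_bound hcl hc hb) hr
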